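/- Formulas are built from variables $x_0,x_1,\dots$ with the constant $\bot$ and the binary connectives $\land,\lor,\to,\prec$. A sequent $\Gamma\Rightarrow\Delta$ is a pair of finite multisets of formulas (equivalently, a finite multiset of formulas labelled "left" or "right"). The sequent calculus $\mathbf{BiInt}$ for bi-intuitionistic logic has the initial sequents $x\Rightarrow x$ ($x$ a variable), the structural rules - weakening: from $\Gamma\Rightarrow\Delta$ infer $\Gamma,\Sigma\Rightarrow\Delta,\Pi$; - contraction: from $\Gamma\Rightarrow\Delta$ infer $\Gamma'\Rightarrow\Delta'$, where $\Gamma',\Delta'$ arise from $\Gamma,\Delta$ by lowering multiplicities without making any of them zero; - multicut: from $\Gamma\Rightarrow\Delta,C^p$ and $C^q,\Sigma\Rightarrow\Pi$ infer $\Gamma,\Sigma\Rightarrow\Delta,\Pi$, where $p,q\ge 1$ are multiplicities and $C$ is called the cut formula; and the logical rules - $(\bot\mathtt l)$: infer $\Gamma,\bot\Rightarrow\Delta$ from no premises; $(\bot\mathtt r)$: from $\Gamma\Rightarrow\Delta$ infer $\Gamma\Rightarrow\bot,\Delta$; - $(\land\mathtt l)$: from $\Gamma,A,B\Rightarrow\Delta$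 infer $\Gamma,A\land B\Rightarrow\Delta$; $(\land\mathtt r)$: from $\Gamma\Rightarrow A,\Delta$ and $\Gamma\Rightarrow B,\Delta$ infer $\Gamma\Rightarrow A\land B,\Delta$; - $(\lor\mathtt l)$: from $\Gamma,A\Rightarrow\Delta$ and $\Gamma,B\Rightarrow\Delta$ infer $\Gamma,A\lor B\Rightarrow\Delta$; $(\lor\mathtt r)$: from $\Gamma\Rightarrow A,B,\Delta$ infer $\Gamma\Rightarrow A\lor B,\Delta$; - $(\to\mathtt l)$: from $\Gamma\Rightarrow A,\Delta$ and $\Gamma,B\Rightarrow\Delta$ infer $\Gamma,A\to B\Rightarrow\Delta$; $(\to\mathtt r)$: from $\Gamma,A\Rightarrow B$ infer $\Gamma\Rightarrow A\to B$ (no other formula on the right); - $(\prec\mathtt l)$: from $A\Rightarrow B,\Delta$ infer $A\prec B\Rightarrow\Delta$ (no other formula on the left); $(\prec\mathtt r)$: from $\Gamma\Rightarrow A,\Delta$ and $\Gamma,B\Rightarrow\Delta$ infer $\Gamma\Rightarrow A\prec B,\Delta$. A proof is a finite tree of instances of these rules whose leaves are initial sequents or instances of $(\bot\mathtt l)$.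 An instance of multicut is analytic if its cut formula is a (not necessarily proper) subformula of some formula in the conclusion of that instance; a proof is locally analytic if every instance of multicut in it is analytic. **Corollary.** $\mathbf{BiInt}$ has the analytic cut property: every provable sequent has a locally analytic proof. Moreover, this holds by a constructive procedure: there is an algorithm that, given (a code of) any proof in $\mathbf{BiInt}$, terminates and outputs (a code of) a locally analytic proof of the same endsequent. -/

import Mathlib

namespace BiInt

/-- Formulas of bi-intuitionistic logic over the variables `x₀, x₁, …`.
`excl A B` is the co-implication (exclusion) `A ≺ B`. -/
inductive Formula : Type
  | var : ℕ → Formula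
  | bot : Formula
  | and : Formula → Formula → Formula
  | or : Formula → Formula → Formula
  | imp : Formula → Formula → Formula
  | excl : Formula → Formula → Formula

/-- `IsSubformula A B`: `A` is a (not necessarily proper) subformula of `B`. -/
def IsSubformula (A : Formula) : Formula → Prop
  | .var x => A = .var x
  | .bot => A = .bot
  | .and B C => A = .and B C ∨ IsSubformula A B ∨ IsSubformula A C
  | .or B C => A = .or B C ∨ IsSubformula A B ∨ IsSubformula A C
  | .imp B C => A = .imp B C ∨ IsSubformula A B ∨ IsSubformula A C
  | .excl B C => A = .excl B C ∨ IsSubformula A B ∨ IsSubformula A C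

/-- Labelled formulas: `left A` is an occurrence of `A` in the antecedent of a sequent,
`right A` an occurrence of `A` in the succedent. -/
inductive LFormula : Type
  | left : Formula → LFormula
  | right : Formula → LFormula

/-- The formula underlying a labelled formula. -/
def LFormula.formula : LFormula → Formula
  | .left A => A
  | .right A => A

/-- The sequent `A₁, …, Aₙ ⇒ B₁, …, Bₘ` is the finite multiset of labelled formulas
`left A₁, …, left Aₙ, right B₁, …, right Bₘ`. -/
abbrev Sequent : Type := Multiset LFormula

open LFormula

/-- `Γ'` is a contraction of `Γ`: they have the same support, and every element occurs in `Γ`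
at least as often as in `Γ'`. -/
def IsContraction (Γ' Γ : Sequent) : Prop :=
  Γ' ≤ Γ ∧ ∀ F, F ∈ Γ → F ∈ Γ'

/-- `Proof S` is the type of proof trees with endsequent `S` in the sequent calculus `BiInt`.
The only rules whose context is restricted are `impR` (context on the left only) and
`exclL` (context on the right only). -/
inductive Proof : Sequent → Type
  | ax (x : ℕ) : Proof {left (.var x), right (.var x)}
  | weak (Γ Δ : Sequent) (π : Proof Γ) : Proof (Γ + Δ)
  | contr (Γ Γ' : Sequent) (h : IsContraction Γ' Γ) (π : Proof Γ) : Proof Γ'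
  | mcut (Γ Δ : Sequent) (C : Formula) (p q : ℕ) (hp : p ≠ 0) (hq : q ≠ 0)
      (π₁ : Proof (Γ + Multiset.replicate p (right C)))
      (π₂ : Proof (Δ + Multiset.replicate q (left C))) : Proof (Γ + Δ)
  | botL (Γ : Sequent) : Proof (left .bot ::ₘ Γ)
  | botR (Γ : Sequent) (π : Proof Γ) : Proof (right .bot ::ₘ Γ)
  | andL (Γ : Sequent) (A B : Formula)
      (π : Proof (left A ::ₘ left B ::ₘ Γ)) : Proof (left (.and A B) ::ₘ Γ)
  | andR (Γ : Sequent) (A B : Formula)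
      (π₁ : Proof (right A ::ₘ Γ)) (π₂ : Proof (right B ::ₘ Γ)) :
      Proof (right (.and A B) ::ₘ Γ)
  | orL (Γ : Sequent) (A B : Formula)
      (π₁ : Proof (left A ::ₘ Γ)) (π₂ : Proof (left B ::ₘ Γ)) :
      Proof (left (.or A B) ::ₘ Γ)
  | orR (Γ : Sequent) (A B : Formula)
      (π : Proof (right A ::ₘ right B ::ₘ Γ)) : Proof (right (.or A B) ::ₘ Γ)
  | impL (Γ : Sequent) (A B : Formula)
      (π₁ : Proof (right A ::ₘ Γ)) (π₂ : Proof (left B ::ₘ Γ)) :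
      Proof (left (.imp A B) ::ₘ Γ)
  | impR (Γ : Multiset Formula) (A B : Formula)
      (π : Proof (left A ::ₘ right B ::ₘ Γ.map left)) :
      Proof (right (.imp A B) ::ₘ Γ.map left)
  | exclL (Δ : Multiset Formula) (A B : Formula)
      (π : Proof (left A ::ₘ right B ::ₘ Δ.map right)) :
      Proof (left (.excl A B) ::ₘ Δ.map right)
  | exclR (Γ : Sequent) (A B : Formula)
      (π₁ : Proof (right A ::ₘ Γ)) (π₂ : Proof (left B ::ₘ Γ)) :
      Proof (right (.excl A B) ::ₘ Γ)

/-- A sequent is provable if it is the endsequent of some proof. -/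
def Provable (S : Sequent) : Prop := Nonempty (Proof S)

/-- A proof is locally analytic if every instance of multicut in it is analytic: its cut formula
is a subformula of some formula in the conclusion of that instance. -/
def Proof.LocallyAnalytic : {S : Sequent} → Proof S → Prop
  | _, .ax _ => True
  | _, .weak _ _ π => π.LocallyAnalytic
  | _, .contr _ _ _ π => π.LocallyAnalytic
  | _, .mcut Γ Δ C _ _ _ _ π₁ π₂ =>
      (∃ F ∈ Γ + Δ, IsSubformula C F.formula) ∧ π₁.LocallyAnalytic ∧ π₂.LocallyAnalytic
  | _, .botL _ => True
  | _, .botR _ π => π.LocallyAnalytic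
  | _, .andL _ _ _ π => π.LocallyAnalytic
  | _, .andR _ _ _ π₁ π₂ => π₁.LocallyAnalytic ∧ π₂.LocallyAnalytic
  | _, .orL _ _ _ π₁ π₂ => π₁.LocallyAnalytic ∧ π₂.LocallyAnalytic
  | _, .orR _ _ _ π => π.LocallyAnalytic
  | _, .impL _ _ _ π₁ π₂ => π₁.LocallyAnalytic ∧ π₂.LocallyAnalytic
  | _, .impR _ _ _ π => π.LocallyAnalytic
  | _, .exclL _ _ _ π => π.LocallyAnalytic
  | _, .exclR _ _ _ π₁ π₂ => π₁.LocallyAnalytic ∧ π₂.LocallyAnalytic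

/-- The analytic cut property: every provable sequent has a locally analytic proof. -/
def AnalyticCutProperty : Prop :=
  ∀ S : Sequent, Provable S → ∃ π : Proof S, π.LocallyAnalytic

/-! Numerical codes of finite objects, needed to speak of algorithms operating on proofs. -/

/-- Code of a formula. -/
def Formula.code : Formula → ℕ
  | .var x => Nat.pair 0 x
  | .bot => Nat.pair 1 0
  | .and A B => Nat.pair 2 (Nat.pair A.code B.code)
  | .or A B => Nat.pair 3 (Nat.pair A.code B.code)
  | .imp A B => Nat.pair 4 (Nat.pair A.code B.code)
  | .excl A B => Nat.pair 5 (Nat.pair A.code B.code)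

/-- Code of a labelled formula. -/
def LFormula.code : LFormula → ℕ
  | .left A => Nat.pair 0 A.code
  | .right A => Nat.pair 1 A.code

/-- Code of a finite multiset of numbers: the code of the list of its elements in
nondecreasing order. -/
def codeMultiset (s : Multiset ℕ) : ℕ := Encodable.encode (s.sort (· ≤ ·))

/-- Code of a sequent. -/
def Sequent.code (S : Sequent) : ℕ := codeMultiset (S.map LFormula.code)

/-- Code of a node of a proof tree: endsequent, number of the rule, parameters of the rule
instance, and codes of the immediate subproofs. -/
def codeNode (S : Sequent) (rule : ℕ) (params subproofs : List ℕ) : ℕ :=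
  Nat.pair (Sequent.code S)
    (Nat.pair rule (Nat.pair (Encodable.encode params) (Encodable.encode subproofs)))

/-- Code of a proof. -/
def Proof.code : {S : Sequent} → Proof S → ℕ
  | _, .ax x => codeNode {left (.var x), right (.var x)} 0 [x] []
  | _, .weak Γ Δ π => codeNode (Γ + Δ) 1 [Sequent.code Γ, Sequent.code Δ] [π.code]
  | _, .contr Γ Γ' _ π => codeNode Γ' 2 [Sequent.code Γ] [π.code]
  | _, .mcut Γ Δ C p q _ _ π₁ π₂ =>
      codeNode (Γ + Δ) 3 [Sequent.code Γ, Sequent.code Δ, C.code, p, q] [π₁.code, π₂.code]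
  | _, .botL Γ => codeNode (left .bot ::ₘ Γ) 4 [Sequent.code Γ] []
  | _, .botR Γ π => codeNode (right .bot ::ₘ Γ) 5 [Sequent.code Γ] [π.code]
  | _, .andL Γ A B π =>
      codeNode (left (.and A B) ::ₘ Γ) 6 [Sequent.code Γ, A.code, B.code] [π.code]
  | _, .andR Γ A B π₁ π₂ =>
      codeNode (right (.and A B) ::ₘ Γ) 7 [Sequent.code Γ, A.code, B.code] [π₁.code, π₂.code]
  | _, .orL Γ A B π₁ π₂ =>
      codeNode (left (.or A B) ::ₘ Γ) 8 [Sequent.code Γ, A.code, B.code] [π₁.code, π₂.code]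
  | _, .orR Γ A B π =>
      codeNode (right (.or A B) ::ₘ Γ) 9 [Sequent.code Γ, A.code, B.code] [π.code]
  | _, .impL Γ A B π₁ π₂ =>
      codeNode (left (.imp A B) ::ₘ Γ) 10 [Sequent.code Γ, A.code, B.code] [π₁.code, π₂.code]
  | _, .impR Γ A B π =>
      codeNode (right (.imp A B) ::ₘ Γ.map left) 11
        [Sequent.code (Γ.map left), A.code, B.code] [π.code]
  | _, .exclL Δ A B π =>
      codeNode (left (.excl A B) ::ₘ Δ.map right) 12
        [Sequent.code (Δ.map right), A.code, B.code] [π.code]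
  | _, .exclR Γ A B π₁ π₂ =>
      codeNode (right (.excl A B) ::ₘ Γ) 13 [Sequent.code Γ, A.code, B.code] [π₁.code, π₂.code]

end BiInt

namespace BiInt

open LFormula Encodable

/-! The argument is semantic. Every proof, with arbitrary cuts, is sound for Kripke models over a
preorder with a persistent valuation, where `imp` looks forward and `excl` looks backward
(`Proof.sound`). Conversely, a sequent without a locally analytic proof fails in a canonical model
whose worlds are the saturated sequents (`canonical_forces`). Hence a provable sequent has a locally
analytic proof.

Analytic cuts are exactly what saturation needs: if adding `C` on the left and adding `C` on the
right both gave provable sequents, a cut on the subformula `C` would prove the original one. So an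
unprovable sequent extends to one deciding all its subformulas, with no other formulas entering
(`exists_saturated`). The delicate point is the world refuting an implication, or witnessing an
exclusion: `impR` and `exclL` keep only one side of the context, so the other half of accessibility
must be recovered. It follows from the subformula bound on the new world, because the old world has
already decided all those formulas.

The algorithm does not transform the given proof. It reads off the endsequent from the code and
searches all locally analytic proofs for one with that endsequent; the semantic theorem guarantees
termination. Candidates are checked primitive recursively: a proof is certified by a finite list of
instructions that assembles it from its subproofs, and `execAll` replays such a list. Its outputs
are exactly the codes of locally analytic proofs (`isAnalyticCode_of_mem_execAll`,
`exists_execAll_of_analytic`). -/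

theorem IsSubformula.refl (A : Formula) : IsSubformula A A := by
  cases A <;> simp [IsSubformula]

theorem IsSubformula.trans {A B C : Formula} (hAB : IsSubformula A B) (hBC : IsSubformula B C) :
    IsSubformula A C := by
  induction C with
  | var x => cases hBC; exact hAB
  | bot => cases hBC; exact hAB
  | and C D ihC ihD | or C D ihC ihD | imp C D ihC ihD | excl C D ihC ihD =>
    rcases hBC with rfl | h | h
    · exact hAB
    · exact .inr (.inl (ihC h))
    · exact .inr (.inr (ihD h))

/-- The list of all subformulas of a formula. -/
def Formula.subformulas : Formula → List Formula
  | .var x => [.var x]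
  | .bot => [.bot]
  | .and A B => .and A B :: (A.subformulas ++ B.subformulas)
  | .or A B => .or A B :: (A.subformulas ++ B.subformulas)
  | .imp A B => .imp A B :: (A.subformulas ++ B.subformulas)
  | .excl A B => .excl A B :: (A.subformulas ++ B.subformulas)

theorem Formula.mem_subformulas {A B : Formula} : A ∈ B.subformulas ↔ IsSubformula A B := by
  induction B <;> simp_all [Formula.subformulas, IsSubformula]

/-! ### Kripke semantics and soundness -/

/-- Truth of a formula at a world of a Kripke model given by a relation `R` and a valuation. -/
def Forces {W : Type} (R : W → W → Prop) (V : W → ℕ → Prop) : W → Formula → Prop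
  | w, .var x => V w x
  | _, .bot => False
  | w, .and A B => Forces R V w A ∧ Forces R V w B
  | w, .or A B => Forces R V w A ∨ Forces R V w B
  | w, .imp A B => ∀ v, R w v → Forces R V v A → Forces R V v B
  | w, .excl A B => ∃ v, R v w ∧ Forces R V v A ∧ ¬ Forces R V v B

/-- The contribution of a labelled formula to the truth of a sequent at a world. -/
def LFormula.Holds {W : Type} (R : W → W → Prop) (V : W → ℕ → Prop) (w : W) : LFormula → Prop
  | .left A => ¬ Forces R V w A
  | .right A => Forces R V w A

theorem Forces.mono {W : Type} {R : W → W → Prop} {V : W → ℕ → Prop}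
    (trans : ∀ u v w, R u v → R v w → R u w) (pers : ∀ v w x, R v w → V v x → V w x)
    {A : Formula} : ∀ {v w : W}, R v w → Forces R V v A → Forces R V w A := by
  induction A with
  | var x => intro v w h; exact pers v w x h
  | bot => intro v w _ h; exact h
  | and A B ihA ihB => intro v w h hA; exact ⟨ihA h hA.1, ihB h hA.2⟩
  | or A B ihA ihB => intro v w h hA; exact hA.imp (ihA h) (ihB h)
  | imp A B => intro v w h hA u hu; exact hA u (trans _ _ _ h hu)
  | excl A B => rintro v w h ⟨u, hu, hA⟩; exact ⟨u, trans _ _ _ hu h, hA⟩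

/-- Persistence is needed only for the two context-restricted rules: a left formula false at a later
world was already false before, and a right formula true at an earlier world stays true. -/
theorem Proof.sound {W : Type} {R : W → W → Prop} {V : W → ℕ → Prop}
    (refl : ∀ w, R w w) (trans : ∀ u v w, R u v → R v w → R u w)
    (pers : ∀ v w x, R v w → V v x → V w x) {S : Sequent} (π : Proof S) :
    ∀ w, ∃ F ∈ S, F.Holds R V w := by
  induction π with
  | ax x => intro w; simp [LFormula.Holds, Forces, em']
  | weak Γ Δ π ih => intro w; obtain ⟨F, h, h'⟩ := ih w; exact ⟨F, by simp [h], h'⟩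
  | contr Γ Γ' h π ih => intro w; obtain ⟨F, hF, h'⟩ := ih w; exact ⟨F, h.2 F hF, h'⟩
  | mcut Γ Δ C p q hp hq π₁ π₂ ih₁ ih₂ =>
    intro w
    obtain ⟨F, h, h'⟩ := ih₁ w
    obtain ⟨G, k, k'⟩ := ih₂ w
    simp only [Multiset.mem_add, Multiset.mem_replicate] at h k ⊢
    rcases h with h | ⟨-, rfl⟩
    · exact ⟨F, .inl h, h'⟩
    rcases k with k | ⟨-, rfl⟩
    · exact ⟨G, .inr k, k'⟩
    exact absurd h' k'
  | botL Γ => intro w; simp [LFormula.Holds, Forces]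
  | botR Γ π ih => intro w; obtain ⟨F, h, h'⟩ := ih w; exact ⟨F, by simp [h], h'⟩
  | andL Γ A B π ih | orR Γ A B π ih =>
    intro w
    have := ih w
    simp only [Multiset.mem_cons, exists_eq_or_imp, LFormula.Holds, Forces] at this ⊢
    tauto
  | andR Γ A B π₁ π₂ ih₁ ih₂ | orL Γ A B π₁ π₂ ih₁ ih₂ =>
    intro w
    have h₁ := ih₁ w
    have h₂ := ih₂ w
    simp only [Multiset.mem_cons, exists_eq_or_imp, LFormula.Holds, Forces] at h₁ h₂ ⊢
    tauto
  | impL Γ A B π₁ π₂ ih₁ ih₂ =>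
    intro w
    have h₁ := ih₁ w
    have h₂ := ih₂ w
    simp only [Multiset.mem_cons, exists_eq_or_imp, LFormula.Holds, Forces] at h₁ h₂ ⊢
    have h := fun h : ∀ v, R w v → Forces R V v A → Forces R V v B => h w (refl w)
    tauto
  | exclR Γ A B π₁ π₂ ih₁ ih₂ =>
    intro w
    have h₁ := ih₁ w
    have h₂ := ih₂ w
    simp only [Multiset.mem_cons, exists_eq_or_imp] at h₁ h₂ ⊢
    rcases h₁ with hA | h
    · rcases h₂ with hB | h
      · exact .inl ⟨w, refl w, hA, hB⟩
      · exact .inr h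
    · exact .inr h
  | impR Γ A B π ih =>
    intro w
    by_contra! hw
    refine hw _ (Multiset.mem_cons_self _ _) fun v hv hA => ?_
    obtain ⟨F, h, h'⟩ := ih v
    simp only [Multiset.mem_cons, Multiset.mem_map] at h
    rcases h with rfl | rfl | ⟨C, hC, rfl⟩
    · exact absurd hA h'
    · exact h'
    · refine absurd (fun hCw => h' (hCw.mono trans pers hv)) (hw (left C) ?_)
      simp [hC]
  | exclL Δ A B π ih =>
    intro w
    by_contra! hw
    refine hw _ (Multiset.mem_cons_self _ _) fun ⟨v, hv, hA, hB⟩ => ?_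
    obtain ⟨F, h, h'⟩ := ih v
    simp only [Multiset.mem_cons, Multiset.mem_map] at h
    rcases h with rfl | rfl | ⟨C, hC, rfl⟩
    · exact h' hA
    · exact hB h'
    · refine hw (right C) ?_ (Forces.mono trans pers hv h')
      simp [hC]

/-! ### Locally analytic provability -/

/-- A sequent is analytically provable if it has a locally analytic proof. -/
def AProvable (S : Sequent) : Prop := ∃ π : Proof S, π.LocallyAnalytic

namespace AProvable

/-- Weakening to `S + T` and contracting to `T` shows that multiplicities never matter for analytic
provability; sequents can be handled as sets from here on. -/
theorem mono {S T : Sequent} (hS : AProvable S) (h : ∀ F ∈ S, F ∈ T) : AProvable T := by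
  obtain ⟨π, hπ⟩ := hS
  have hc : IsContraction T (S + T) :=
    ⟨Multiset.le_add_left _ _, fun F hF => (Multiset.mem_add.1 hF).elim (h F) id⟩
  exact ⟨.contr (S + T) T hc (.weak S T π), hπ⟩

theorem cut {S : Sequent} {C : Formula} (h₁ : AProvable (right C ::ₘ S))
    (h₂ : AProvable (left C ::ₘ S)) (hC : ∃ F ∈ S, IsSubformula C F.formula) : AProvable S := by
  have e : ∀ F : LFormula, F ::ₘ S = S + Multiset.replicate 1 F := fun F => by
    rw [Multiset.replicate_one, Multiset.add_comm, Multiset.singleton_add]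
  rw [e] at h₁ h₂
  obtain ⟨π₁, hπ₁⟩ := h₁
  obtain ⟨π₂, hπ₂⟩ := h₂
  obtain ⟨F, hF, hCF⟩ := hC
  have : AProvable (S + S) :=
    ⟨.mcut S S C 1 1 one_ne_zero one_ne_zero π₁ π₂, ⟨F, by simp [hF], hCF⟩, hπ₁, hπ₂⟩
  exact this.mono (by simp)

variable {Γ : Sequent} {A B : Formula}

theorem botL : AProvable (left .bot ::ₘ Γ) := ⟨.botL Γ, trivial⟩

theorem andL : AProvable (left A ::ₘ left B ::ₘ Γ) → AProvable (left (.and A B) ::ₘ Γ)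
  | ⟨π, h⟩ => ⟨.andL Γ A B π, h⟩

theorem andR : AProvable (right A ::ₘ Γ) → AProvable (right B ::ₘ Γ) →
    AProvable (right (.and A B) ::ₘ Γ)
  | ⟨π₁, h₁⟩, ⟨π₂, h₂⟩ => ⟨.andR Γ A B π₁ π₂, h₁, h₂⟩

theorem orL : AProvable (left A ::ₘ Γ) → AProvable (left B ::ₘ Γ) →
    AProvable (left (.or A B) ::ₘ Γ)
  | ⟨π₁, h₁⟩, ⟨π₂, h₂⟩ => ⟨.orL Γ A B π₁ π₂, h₁, h₂⟩

theorem orR : AProvable (right A ::ₘ right B ::ₘ Γ) → AProvable (right (.or A B) ::ₘ Γ)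
  | ⟨π, h⟩ => ⟨.orR Γ A B π, h⟩

theorem impL : AProvable (right A ::ₘ Γ) → AProvable (left B ::ₘ Γ) →
    AProvable (left (.imp A B) ::ₘ Γ)
  | ⟨π₁, h₁⟩, ⟨π₂, h₂⟩ => ⟨.impL Γ A B π₁ π₂, h₁, h₂⟩

theorem impR {Γ : Multiset Formula} : AProvable (left A ::ₘ right B ::ₘ Γ.map left) →
    AProvable (right (.imp A B) ::ₘ Γ.map left)
  | ⟨π, h⟩ => ⟨.impR Γ A B π, h⟩

theorem exclL {Δ : Multiset Formula} : AProvable (left A ::ₘ right B ::ₘ Δ.map right) →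
    AProvable (left (.excl A B) ::ₘ Δ.map right)
  | ⟨π, h⟩ => ⟨.exclL Δ A B π, h⟩

theorem exclR : AProvable (right A ::ₘ Γ) → AProvable (left B ::ₘ Γ) →
    AProvable (right (.excl A B) ::ₘ Γ)
  | ⟨π₁, h₁⟩, ⟨π₂, h₂⟩ => ⟨.exclR Γ A B π₁ π₂, h₁, h₂⟩

/-- Compound identities reduce to variables without cuts. For `imp` and `excl` the
context-restricted rule comes last, when only the principal formula is left as context. -/
theorem identity (C : Formula) : ∀ {S : Sequent}, left C ∈ S → right C ∈ S → AProvable S := by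
  suffices h : AProvable {left C, right C} from fun {S} hl hr => h.mono (by simp [hl, hr])
  have m : ∀ {C : Formula} {S : Sequent}, AProvable {left C, right C} →
      left C ∈ S → right C ∈ S → AProvable S := fun h hl hr => h.mono (by simp [hl, hr])
  induction C with
  | var x => exact ⟨.ax x, trivial⟩
  | bot => exact botL
  | and A B ihA ihB =>
    exact andL (mono (andR (A := A) (B := B) (Γ := {left A, left B}) (m ihA (by simp) (by simp))
      (m ihB (by simp) (by simp))) (by simp))
  | or A B ihA ihB =>
    exact orL (mono (orR (A := A) (B := B) (Γ := {left A}) (m ihA (by simp) (by simp))) (by simp))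
      (mono (orR (A := A) (B := B) (Γ := {left B}) (m ihB (by simp) (by simp))) (by simp))
  | imp A B ihA ihB =>
    refine mono (impR (A := A) (B := B) (Γ := {.imp A B}) (mono (impL (A := A) (B := B)
      (Γ := {left A, right B}) (m ihA ?_ ?_) (m ihB ?_ ?_)) ?_)) ?_ <;> simp
  | excl A B ihA ihB =>
    refine exclL (Δ := {.excl A B}) (mono (exclR (A := A) (B := B)
      (Γ := {left A, right B}) (m ihA ?_ ?_) (m ihB ?_ ?_)) ?_) <;> simp

end AProvable

/-! ### The canonical model -/

/-- A sequent is saturated if it is not analytically provable and decides all subformulas of its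
formulas. -/
def Saturated (S : Sequent) : Prop :=
  ¬ AProvable S ∧ ∀ F ∈ S, ∀ C, IsSubformula C F.formula → left C ∈ S ∨ right C ∈ S

theorem exists_decided {S : Sequent} (hS : ¬ AProvable S) (l : List Formula)
    (hl : ∀ C ∈ l, ∃ F ∈ S, IsSubformula C F.formula) :
    ∃ T : Sequent, S ≤ T ∧ ¬ AProvable T ∧ (∀ C ∈ l, left C ∈ T ∨ right C ∈ T) ∧
      ∀ G ∈ T, ∃ F ∈ S, IsSubformula G.formula F.formula := by
  induction l with
  | nil => exact ⟨S, le_rfl, hS, by simp, fun G hG => ⟨G, hG, .refl _⟩⟩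
  | cons C l ih =>
    obtain ⟨T, hST, hT, hd, hs⟩ := ih fun D hD => hl D (List.mem_cons_of_mem _ hD)
    obtain ⟨F, hF, hCF⟩ := hl C List.mem_cons_self
    -- If both extensions were provable, a cut on `C` would prove `T`; it is analytic because `C` is
    -- a subformula of a member of `S`, hence of `T`.
    have key : ∃ G : LFormula, (G = left C ∨ G = right C) ∧ ¬ AProvable (G ::ₘ T) := by
      by_contra! h
      exact hT ((h _ (.inr rfl)).cut (h _ (.inl rfl)) ⟨F, Multiset.mem_of_le hST hF, hCF⟩)
    obtain ⟨G, hG, hGT⟩ := key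
    refine ⟨G ::ₘ T, hST.trans (Multiset.le_cons_self _ _), hGT, ?_, ?_⟩
    · intro D hD
      rcases List.mem_cons.1 hD with rfl | hD
      · rcases hG with rfl | rfl <;> simp
      · exact (hd D hD).imp (Multiset.mem_cons_of_mem) (Multiset.mem_cons_of_mem)
    · intro H hH
      rcases Multiset.mem_cons.1 hH with rfl | hH
      · exact ⟨F, hF, by rcases hG with rfl | rfl <;> exact hCF⟩
      · exact hs H hH

theorem exists_saturated {S : Sequent} (hS : ¬ AProvable S) :
    ∃ T : Sequent, S ≤ T ∧ Saturated T ∧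
      ∀ G ∈ T, ∃ F ∈ S, IsSubformula G.formula F.formula := by
  obtain ⟨T, hST, hT, hd, hs⟩ := exists_decided hS
    (S.toList.flatMap fun F => F.formula.subformulas)
    (by simp [Formula.mem_subformulas])
  refine ⟨T, hST, ⟨hT, fun G hG C hC => hd C ?_⟩, hs⟩
  obtain ⟨F, hF, hGF⟩ := hs G hG
  simpa [Formula.mem_subformulas] using ⟨F, hF, hC.trans hGF⟩

/-- The accessibility relation of the canonical model. -/
def CanonicalLE (S T : {S : Sequent // Saturated S}) : Prop :=
  (∀ C, left C ∈ S.1 → left C ∈ T.1) ∧ ∀ C, right C ∈ T.1 → right C ∈ S.1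

/-- The valuation of the canonical model. -/
def CanonicalVal (S : {S : Sequent // Saturated S}) (x : ℕ) : Prop := left (.var x) ∈ S.1

/-- Saturating `A`, `B` and the left part of `S` gives the upper world. Its right formulas are all
subformulas of formulas in `S`, so `S` decides them; none is on the left of `S`, as it would then
lie on both sides of `T`. -/
theorem exists_canonicalLE_of_imp (S : {S : Sequent // Saturated S}) {A B : Formula}
    (h : right (.imp A B) ∈ S.1) :
    ∃ T, CanonicalLE S T ∧ left A ∈ T.1 ∧ right B ∈ T.1 := by
  classical
  obtain ⟨Γ, hΓ⟩ : ∃ Γ : Multiset Formula, ∀ C, C ∈ Γ ↔ left C ∈ S.1 := by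
    refine ⟨(S.1.filter fun F => F = left F.formula).map LFormula.formula, fun C => ?_⟩
    simp only [Multiset.mem_map, Multiset.mem_filter]
    exact ⟨fun ⟨F, ⟨hF, h⟩, e⟩ => e ▸ h ▸ hF, fun h => ⟨_, ⟨h, rfl⟩, rfl⟩⟩
  -- Otherwise `impR` would prove `S`, whose own member `right (.imp A B)` absorbs the conclusion.
  have hn : ¬ AProvable (left A ::ₘ right B ::ₘ Γ.map left) := fun hp =>
    S.2.1 (hp.impR.mono (by simp [h, hΓ]))
  obtain ⟨T, hT, hsat, hs⟩ := exists_saturated hn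
  have hT' := fun F => Multiset.mem_of_le (a := F) hT
  have hl : ∀ C, left C ∈ S.1 → left C ∈ T := fun C hC => hT' _ (by simp [hΓ, hC])
  refine ⟨⟨T, hsat⟩, ⟨hl, fun C hC => ?_⟩, hT' _ (by simp), hT' _ (by simp)⟩
  suffices hC' : left C ∈ S.1 ∨ right C ∈ S.1 from
    hC'.resolve_left fun h => hsat.1 (.identity C (hl C h) hC)
  obtain ⟨F, hF, hCF⟩ := hs _ hC
  simp only [Multiset.mem_cons, Multiset.mem_map, hΓ] at hF
  rcases hF with rfl | rfl | ⟨D, hD, rfl⟩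
  · exact S.2.2 _ h C (.inr (.inl hCF))
  · exact S.2.2 _ h C (.inr (.inr hCF))
  · exact S.2.2 _ hD C hCF

theorem exists_canonicalLE_of_excl (S : {S : Sequent // Saturated S}) {A B : Formula}
    (h : left (.excl A B) ∈ S.1) :
    ∃ T, CanonicalLE T S ∧ left A ∈ T.1 ∧ right B ∈ T.1 := by
  classical
  obtain ⟨Δ, hΔ⟩ : ∃ Δ : Multiset Formula, ∀ C, C ∈ Δ ↔ right C ∈ S.1 := by
    refine ⟨(S.1.filter fun F => F = right F.formula).map LFormula.formula, fun C => ?_⟩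
    simp only [Multiset.mem_map, Multiset.mem_filter]
    exact ⟨fun ⟨F, ⟨hF, h⟩, e⟩ => e ▸ h ▸ hF, fun h => ⟨_, ⟨h, rfl⟩, rfl⟩⟩
  have hn : ¬ AProvable (left A ::ₘ right B ::ₘ Δ.map right) := fun hp =>
    S.2.1 (hp.exclL.mono (by simp [h, hΔ]))
  obtain ⟨T, hT, hsat, hs⟩ := exists_saturated hn
  have hT' := fun F => Multiset.mem_of_le (a := F) hT
  have hr : ∀ C, right C ∈ S.1 → right C ∈ T := fun C hC => hT' _ (by simp [hΔ, hC])
  refine ⟨⟨T, hsat⟩, ⟨fun C hC => ?_, hr⟩, hT' _ (by simp), hT' _ (by simp)⟩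
  -- Dually, `C` cannot be on the right of `S`, since right formulas are carried down to `T`.
  suffices hC' : left C ∈ S.1 ∨ right C ∈ S.1 from
    hC'.resolve_right fun h => hsat.1 (.identity C hC (hr C h))
  obtain ⟨F, hF, hCF⟩ := hs _ hC
  simp only [Multiset.mem_cons, Multiset.mem_map, hΔ] at hF
  rcases hF with rfl | rfl | ⟨D, hD, rfl⟩
  · exact S.2.2 _ h C (.inr (.inl hCF))
  · exact S.2.2 _ h C (.inr (.inr hCF))
  · exact S.2.2 _ hD C hCF

theorem canonical_forces (C : Formula) : ∀ S : {S : Sequent // Saturated S},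
    (left C ∈ S.1 → Forces CanonicalLE CanonicalVal S C) ∧
      (right C ∈ S.1 → ¬ Forces CanonicalLE CanonicalVal S C) := by
  -- A formula already in `S` may be repeated for use as the principal formula of a rule.
  have im : ∀ {F : LFormula} {S : Sequent}, F ∈ S → AProvable (F ::ₘ S) → AProvable S :=
    fun hF h => h.mono (by simp [hF])
  induction C with
  | var x => exact fun S => ⟨id, fun hr hl => S.2.1 (.identity _ hl hr)⟩
  | bot => exact fun S => ⟨fun h => S.2.1 (im h .botL), fun _ => id⟩
  | and A B ihA ihB =>
    intro S
    have dA : ∀ {F : LFormula}, F ∈ S.1 → F.formula = .and A B → left A ∈ S.1 ∨ right A ∈ S.1 :=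
      fun h e => S.2.2 _ h A (e ▸ .inr (.inl (.refl A)))
    have dB : ∀ {F : LFormula}, F ∈ S.1 → F.formula = .and A B → left B ∈ S.1 ∨ right B ∈ S.1 :=
      fun h e => S.2.2 _ h B (e ▸ .inr (.inr (.refl B)))
    refine ⟨fun h => ⟨(ihA S).1 ?_, (ihB S).1 ?_⟩, fun h ⟨hA, hB⟩ => ?_⟩
    · exact (dA h rfl).resolve_right fun hr =>
        S.2.1 (im h (.andL (.identity A (by simp) (by simp [hr]))))
    · exact (dB h rfl).resolve_right fun hr =>
        S.2.1 (im h (.andL (.identity B (by simp) (by simp [hr]))))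
    · have hlA := (dA h rfl).resolve_right fun hr => (ihA S).2 hr hA
      have hlB := (dB h rfl).resolve_right fun hr => (ihB S).2 hr hB
      exact S.2.1 (im h (.andR (.identity A (by simp [hlA]) (by simp))
        (.identity B (by simp [hlB]) (by simp))))
  | or A B ihA ihB =>
    intro S
    have dA : ∀ {F : LFormula}, F ∈ S.1 → F.formula = .or A B → left A ∈ S.1 ∨ right A ∈ S.1 :=
      fun h e => S.2.2 _ h A (e ▸ .inr (.inl (.refl A)))
    have dB : ∀ {F : LFormula}, F ∈ S.1 → F.formula = .or A B → left B ∈ S.1 ∨ right B ∈ S.1 :=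
      fun h e => S.2.2 _ h B (e ▸ .inr (.inr (.refl B)))
    refine ⟨fun h => ?_, fun h hAB => hAB.elim ((ihA S).2 ?_) ((ihB S).2 ?_)⟩
    · by_contra hn
      have hrA := (dA h rfl).resolve_left fun hl => hn (.inl ((ihA S).1 hl))
      have hrB := (dB h rfl).resolve_left fun hl => hn (.inr ((ihB S).1 hl))
      exact S.2.1 (im h (.orL (.identity A (by simp) (by simp [hrA]))
        (.identity B (by simp) (by simp [hrB]))))
    · exact (dA h rfl).resolve_left fun hl =>
        S.2.1 (im h (.orR (.identity A (by simp [hl]) (by simp))))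
    · exact (dB h rfl).resolve_left fun hl =>
        S.2.1 (im h (.orR (.identity B (by simp [hl]) (by simp))))
  | imp A B ihA ihB =>
    intro S
    refine ⟨fun h T hT hA => ?_, fun h hAB => ?_⟩
    -- The implication itself is carried to `T`, so `T` decides `A` and `B` and `impL` applies
    -- there.
    · have h := hT.1 _ h
      have hA := (T.2.2 _ h A (.inr (.inl (.refl A)))).resolve_right fun hr => (ihA T).2 hr hA
      refine (ihB T).1 ((T.2.2 _ h B (.inr (.inr (.refl B)))).resolve_right fun hr => ?_)
      exact T.2.1 (im h (.impL (.identity A (by simp [hA]) (by simp))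
        (.identity B (by simp) (by simp [hr]))))
    · obtain ⟨T, hT, hA, hB⟩ := exists_canonicalLE_of_imp S h
      exact (ihB T).2 hB (hAB T hT ((ihA T).1 hA))
  | excl A B ihA ihB =>
    intro S
    refine ⟨fun h => ?_, fun h ⟨T, hT, hA, hB⟩ => ?_⟩
    · obtain ⟨T, hT, hA, hB⟩ := exists_canonicalLE_of_excl S h
      exact ⟨T, hT, (ihA T).1 hA, (ihB T).2 hB⟩
    · have h := hT.2 _ h
      have hA := (T.2.2 _ h A (.inr (.inl (.refl A)))).resolve_right fun hr => (ihA T).2 hr hA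
      have hB := (T.2.2 _ h B (.inr (.inr (.refl B)))).resolve_left fun hl => hB ((ihB T).1 hl)
      exact T.2.1 (im h (.exclR (.identity A (by simp [hA]) (by simp))
        (.identity B (by simp) (by simp [hB]))))

theorem analyticCutProperty : AnalyticCutProperty := by
  intro S ⟨π⟩
  by_contra hS
  obtain ⟨T, hST, hT, -⟩ := exists_saturated hS
  obtain ⟨F, hF, hF'⟩ := π.sound (R := CanonicalLE) (V := CanonicalVal)
    (fun _ => ⟨fun _ => id, fun _ => id⟩)
    (fun _ _ _ h k => ⟨fun C hC => k.1 C (h.1 C hC), fun C hC => h.2 C (k.2 C hC)⟩)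
    (fun _ _ x h hx => h.1 (.var x) hx) ⟨T, hT⟩
  have hF := Multiset.mem_of_le hST hF
  cases F with
  | left C => exact hF' ((canonical_forces C _).1 hF)
  | right C => exact (canonical_forces C _).2 hF hF'

/-! ### Formulas and sequents as primitively coded types -/

/-- The codes of the immediate subformulas of the formula with code `n`. -/
def codeComponents (n : ℕ) : List ℕ :=
  if 2 ≤ n.unpair.1 ∧ n.unpair.1 ≤ 5 then [n.unpair.2.unpair.1, n.unpair.2.unpair.2] else []

/-- The codes reached from `n` by at most `k` passages to immediate components. -/
def codeDescendants (k n : ℕ) : List ℕ :=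
  (fun L : List ℕ => L ++ L.flatMap codeComponents)^[k] [n]

theorem mem_iterate_codeComponents {k m : ℕ} : ∀ {L : List ℕ},
    m ∈ (fun L : List ℕ => L ++ L.flatMap codeComponents)^[k] L ↔
      ∃ n ∈ L, m ∈ codeDescendants k n := by
  induction k with
  | zero => simp [codeDescendants]
  | succ k ih =>
    intro L
    rw [Function.iterate_succ_apply, ih]
    have h : ∀ n, m ∈ codeDescendants (k + 1) n ↔
        ∃ a ∈ [n] ++ [n].flatMap codeComponents, m ∈ codeDescendants k a := fun n => ih
    simp only [h, List.mem_append, List.mem_flatMap, List.mem_singleton]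
    constructor
    · rintro ⟨n, hn | ⟨a, ha, hn⟩, hm⟩
      · exact ⟨n, hn, n, .inl rfl, hm⟩
      · exact ⟨a, ha, n, .inr ⟨a, rfl, hn⟩, hm⟩
    · rintro ⟨n, hn, a, rfl | ⟨b, rfl, ha⟩, hm⟩
      · exact ⟨a, .inl hn, hm⟩
      · exact ⟨a, .inr ⟨b, hn, ha⟩, hm⟩

theorem mem_codeDescendants_succ {k n m : ℕ} :
    m ∈ codeDescendants (k + 1) n ↔ m = n ∨ ∃ a ∈ codeComponents n, m ∈ codeDescendants k a := by
  have key : ∀ k n, m ∈ codeDescendants (k + 1) n ↔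
      m ∈ codeDescendants k n ∨ ∃ a ∈ codeComponents n, m ∈ codeDescendants k a := by
    intro k n
    rw [codeDescendants, Function.iterate_succ_apply, mem_iterate_codeComponents]
    simp [or_and_right, exists_or]
  induction k with
  | zero => rw [key]; simp [codeDescendants]
  | succ k ih =>
    refine (key _ _).trans ((or_congr_left ih).trans ?_)
    constructor
    · rintro ((rfl | ⟨a, ha, h⟩) | h)
      · exact .inl rfl
      · exact .inr ⟨a, ha, (key k a).2 (.inl h)⟩
      · exact .inr h
    · rintro (rfl | h)
      · exact .inl (.inl rfl)
      · exact .inr h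

/-- Components of a compound code are strictly smaller than it, because its tag is at least 2. The
code itself therefore bounds the depth needed to reach all subformulas. -/
theorem mem_codeDescendants_code {m : ℕ} (A : Formula) : ∀ {k : ℕ}, A.code ≤ k →
    (m ∈ codeDescendants (k + 1) A.code ↔ ∃ C, IsSubformula C A ∧ C.code = m) := by
  have key : ∀ (i : ℕ) (A B : Formula), 2 ≤ i → i ≤ 5 →
      codeComponents (Nat.pair i (Nat.pair A.code B.code)) = [A.code, B.code] := by
    intro i A B h₁ h₂
    simp [codeComponents, h₁, h₂]
  have lt : ∀ {i a b : ℕ}, 2 ≤ i → a < Nat.pair i (Nat.pair a b) ∧ b < Nat.pair i (Nat.pair a b) :=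
    fun {i a b} h => by
      have := Nat.add_le_pair i (Nat.pair a b)
      have := Nat.left_le_pair a b
      have := Nat.right_le_pair a b
      omega
  induction A with
  | var x | bot =>
    intro k _
    rw [mem_codeDescendants_succ]
    simp [codeComponents, Formula.code, IsSubformula, eq_comm]
  | and A B ihA ihB | or A B ihA ihB | imp A B ihA ihB | excl A B ihA ihB =>
    intro k hk
    rw [Formula.code] at hk ⊢
    obtain ⟨k, rfl⟩ : ∃ j, k = j + 1 :=
      ⟨k - 1, by have := (lt (i := _) (a := A.code) (b := B.code) (by norm_num)).1.trans_le hk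
                 omega⟩
    have hA := (lt (by norm_num)).1.trans_le hk
    have hB := (lt (by norm_num)).2.trans_le hk
    rw [mem_codeDescendants_succ, key _ _ _ (by norm_num) (by norm_num)]
    simp only [List.mem_cons, List.not_mem_nil, or_false, exists_eq_left,
      ihA (Nat.le_of_lt_succ hA), ihB (Nat.le_of_lt_succ hB), IsSubformula, or_and_right, exists_or,
      Formula.code, eq_comm]

theorem Formula.code_injective : Function.Injective Formula.code := by
  intro A
  induction A with
  | var x => intro B h; cases B <;> simp_all [Formula.code, Nat.pair_eq_pair]
  | bot => intro B h; cases B <;> simp_all [Formula.code, Nat.pair_eq_pair]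
  | and A A' ih ih' | or A A' ih ih' | imp A A' ih ih' | excl A A' ih ih' =>
    intro B h
    cases B <;> simp [Formula.code, Nat.pair_eq_pair] at h ⊢
    exact ⟨ih h.1, ih' h.2⟩

/-- The condition on a code that its outermost symbol is legitimate. -/
def IsHeadCode (n : ℕ) : Prop :=
  n.unpair.1 = 0 ∨ (n.unpair.1 = 1 ∧ n.unpair.2 = 0) ∨ (2 ≤ n.unpair.1 ∧ n.unpair.1 ≤ 5)

/-- The condition on a number to be the code of a formula. -/
def IsFormulaCode (n : ℕ) : Prop := ∀ m ∈ codeDescendants (n + 1) n, IsHeadCode m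

theorem Formula.isFormulaCode_code (A : Formula) : IsFormulaCode A.code := by
  intro m hm
  obtain ⟨C, -, rfl⟩ := (mem_codeDescendants_code A le_rfl).1 hm
  cases C <;> simp [IsHeadCode, Formula.code]

theorem exists_code_eq (n : ℕ) : ∀ {k : ℕ}, n ≤ k →
    (∀ m ∈ codeDescendants (k + 1) n, IsHeadCode m) → ∃ A : Formula, A.code = n := by
  induction n using Nat.strong_induction_on with
  | _ n ih =>
    intro k hk h
    simp only [mem_codeDescendants_succ] at h
    obtain h0 | ⟨h1, h2⟩ | h2 := h n (.inl rfl)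
    · exact ⟨.var n.unpair.2, by rw [Formula.code, ← h0, Nat.pair_unpair]⟩
    · exact ⟨.bot, by rw [Formula.code, ← h1, ← h2, h1, ← h1, Nat.pair_unpair]⟩
    · have hc : codeComponents n = [n.unpair.2.unpair.1, n.unpair.2.unpair.2] := if_pos h2
      have hn := Nat.add_le_pair n.unpair.1 n.unpair.2
      rw [Nat.pair_unpair] at hn
      have hl := Nat.unpair_left_le n.unpair.2
      have hr := Nat.unpair_right_le n.unpair.2
      obtain ⟨k, rfl⟩ : ∃ j, k = j + 1 := ⟨k - 1, by omega⟩
      obtain ⟨A, hA⟩ := ih n.unpair.2.unpair.1 (by omega) (k := k) (by omega)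
        fun m hm => h m (.inr ⟨_, by simp [hc], hm⟩)
      obtain ⟨B, hB⟩ := ih n.unpair.2.unpair.2 (by omega) (k := k) (by omega)
        fun m hm => h m (.inr ⟨_, by simp [hc], hm⟩)
      have e : ∀ i, n.unpair.1 = i → Nat.pair i (Nat.pair A.code B.code) = n := by
        rintro i rfl
        rw [hA, hB, Nat.pair_unpair, Nat.pair_unpair]
      have : n.unpair.1 = 2 ∨ n.unpair.1 = 3 ∨ n.unpair.1 = 4 ∨ n.unpair.1 = 5 := by omega
      obtain hi | hi | hi | hi := this
      exacts [⟨.and A B, e _ hi⟩, ⟨.or A B, e _ hi⟩, ⟨.imp A B, e _ hi⟩, ⟨.excl A B, e _ hi⟩]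

theorem primrec_codeComponents : Primrec codeComponents := by
  have h1 : Primrec fun n : ℕ => n.unpair.1 := Primrec.fst.comp Primrec.unpair
  have h2 : Primrec fun n : ℕ => n.unpair.2 := Primrec.snd.comp Primrec.unpair
  exact Primrec.ite
    (.and (Primrec.nat_le.comp (.const 2) h1) (Primrec.nat_le.comp h1 (.const 5)))
    (Primrec.list_cons.comp (h1.comp h2) (Primrec.list_cons.comp (h2.comp h2) (.const [])))
    (.const [])

theorem primrec_codeDescendants : Primrec fun n => codeDescendants (n + 1) n :=
  Primrec.nat_iterate Primrec.succ (Primrec.list_cons.comp .id (.const []))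
    ((Primrec.list_append.comp .snd
      (Primrec.list_flatMap .snd (primrec_codeComponents.comp₂ .right))).to₂)

theorem primrecPred_isFormulaCode : PrimrecPred IsFormulaCode := by
  have h1 : Primrec fun n : ℕ => n.unpair.1 := Primrec.fst.comp Primrec.unpair
  have h2 : Primrec fun n : ℕ => n.unpair.2 := Primrec.snd.comp Primrec.unpair
  have h : PrimrecPred IsHeadCode :=
    .or (Primrec.eq.comp h1 (.const 0)) (.or (.and (Primrec.eq.comp h1 (.const 1))
      (Primrec.eq.comp h2 (.const 0)))
      (.and (Primrec.nat_le.comp (.const 2) h1) (Primrec.nat_le.comp h1 (.const 5))))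
  exact h.forall_mem_list.comp primrec_codeDescendants

/-- Formulas correspond to the numbers satisfying `IsFormulaCode`. -/
noncomputable def Formula.equivCode : Formula ≃ {n // IsFormulaCode n} :=
  .ofBijective (fun A => ⟨A.code, A.isFormulaCode_code⟩)
    ⟨fun _ _ h => Formula.code_injective (congrArg Subtype.val h), fun ⟨n, hn⟩ => by
      obtain ⟨A, rfl⟩ := exists_code_eq n le_rfl hn
      exact ⟨A, rfl⟩⟩

noncomputable instance : Primcodable Formula :=
  haveI : DecidablePred IsFormulaCode := Classical.decPred _
  letI := Primcodable.subtype primrecPred_isFormulaCode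
  Primcodable.ofEquiv _ Formula.equivCode

/-- The `Primcodable` structure is transported along `Formula.code`, so computability statements
concern the prescribed codes. -/
theorem Formula.encode_eq (A : Formula) : encode A = A.code := rfl

/-- A labelled formula is a formula together with a Boolean, `true` meaning `right`. -/
def LFormula.equivProd : LFormula ≃ Bool × Formula where
  toFun | .left A => (false, A) | .right A => (true, A)
  invFun | (false, A) => .left A | (true, A) => .right A
  left_inv F := by cases F <;> rfl
  right_inv F := by rcases F with ⟨_ | _, A⟩ <;> rfl

noncomputable instance : Primcodable LFormula := Primcodable.ofEquiv _ LFormula.equivProd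

theorem LFormula.encode_eq (F : LFormula) : encode F = F.code := by
  cases F <;> rfl

theorem LFormula.code_injective : Function.Injective LFormula.code := by
  intro F G h
  rw [← LFormula.encode_eq, ← LFormula.encode_eq] at h
  exact encode_injective h

theorem Sequent.code_injective : Function.Injective Sequent.code := by
  intro S T h
  have h := congrArg (fun l : List ℕ => (l : Multiset ℕ)) (encode_injective h)
  simp only [Multiset.sort_eq] at h
  exact Multiset.map_injective LFormula.code_injective h

/-! ### Primitive recursiveness of the syntax -/

theorem primrec_var : Primrec Formula.var :=
  Primrec.encode_iff.1 (Primrec₂.natPair.comp (.const 0) .id)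

theorem primrec_and : Primrec₂ Formula.and :=
  Primrec₂.encode_iff.1 (Primrec₂.natPair.comp (.const 2)
    (Primrec₂.natPair.comp (Primrec.encode.comp .fst) (Primrec.encode.comp .snd))).to₂

theorem primrec_or : Primrec₂ Formula.or :=
  Primrec₂.encode_iff.1 (Primrec₂.natPair.comp (.const 3)
    (Primrec₂.natPair.comp (Primrec.encode.comp .fst) (Primrec.encode.comp .snd))).to₂

theorem primrec_imp : Primrec₂ Formula.imp :=
  Primrec₂.encode_iff.1 (Primrec₂.natPair.comp (.const 4)
    (Primrec₂.natPair.comp (Primrec.encode.comp .fst) (Primrec.encode.comp .snd))).to₂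

theorem primrec_excl : Primrec₂ Formula.excl :=
  Primrec₂.encode_iff.1 (Primrec₂.natPair.comp (.const 5)
    (Primrec₂.natPair.comp (Primrec.encode.comp .fst) (Primrec.encode.comp .snd))).to₂

theorem primrec_left : Primrec left :=
  Primrec.encode_iff.1 (Primrec₂.natPair.comp (.const 0) Primrec.encode)

theorem primrec_right : Primrec right :=
  Primrec.encode_iff.1 (Primrec₂.natPair.comp (.const 1) Primrec.encode)

theorem primrec_formula : Primrec LFormula.formula :=
  (Primrec.snd.comp (Primrec.of_equiv (e := LFormula.equivProd))).of_eq fun F => by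
    cases F <;> rfl

theorem primrecRel_mem {α : Type*} [Primcodable α] :
    PrimrecRel fun (a : α) (l : List α) => a ∈ l :=
  (PrimrecRel.exists_mem_list (R := fun a b : α => a = b) Primrec.eq).swap.of_eq
    fun a l => by simp [Function.swap]

theorem primrecRel_isSubformula : PrimrecRel IsSubformula :=
  (primrecRel_mem.comp (Primrec.encode.comp .fst)
    (primrec_codeDescendants.comp (Primrec.encode.comp .snd))).of_eq fun ⟨A, B⟩ => by
      rw [Formula.encode_eq, Formula.encode_eq, mem_codeDescendants_code B le_rfl]
      exact ⟨fun ⟨C, hC, h⟩ => Formula.code_injective h ▸ hC, fun h => ⟨A, h, rfl⟩⟩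

theorem primrec_orderedInsert : Primrec₂ fun (a : ℕ) (l : List ℕ) => l.orderedInsert (· ≤ ·) a := by
  have h : Primrec₂ fun (p : ℕ × List ℕ) (q : ℕ × List ℕ × List ℕ) =>
      if p.1 ≤ q.1 then p.1 :: q.1 :: q.2.1 else q.1 :: q.2.2 := by
    refine Primrec.ite ?_ ?_ ?_
    · exact Primrec.nat_le.comp (.comp .fst .fst) (.comp .fst .snd)
    · exact Primrec.list_cons.comp (.comp .fst .fst) (Primrec.list_cons.comp (.comp .fst .snd)
        (.comp .fst (.comp .snd .snd)))
    · exact Primrec.list_cons.comp (.comp .fst .snd) (.comp .snd (.comp .snd .snd))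
  have : Primrec fun p : ℕ × List ℕ => (List.rec [p.1]
      (fun b l IH => if p.1 ≤ b then p.1 :: b :: l else b :: IH) p.2 : List ℕ) :=
    Primrec.list_rec .snd (Primrec.list_cons.comp .fst (.const [])) h
  refine this.of_eq fun ⟨a, l⟩ => ?_
  induction l with
  | nil => rfl
  | cons b l ih => simp only [List.orderedInsert] at ih ⊢; rw [ih]

/-- Sequents are represented by lists; sorting the codes makes the result independent of the order,
and insertion sort is a primitive recursive fold. -/
theorem primrec_sequentCode : Primrec fun l : List LFormula => Sequent.code l := by
  have h : Primrec fun l : List ℕ => l.insertionSort (· ≤ ·) :=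
    Primrec.list_foldr .id (.const []) (primrec_orderedInsert.comp₂ (Primrec.fst.comp₂ .right)
      (Primrec.snd.comp₂ .right))
  refine (Primrec.encode.comp (h.comp (Primrec.list_map .id
    (Primrec.encode.comp₂ .right)))).of_eq fun l => ?_
  simp only [Sequent.code, codeMultiset, Multiset.map_coe, Multiset.coe_sort,
    List.mergeSort_eq_insertionSort, id, funext LFormula.encode_eq]

theorem primrec_replicate {α : Type*} [Primcodable α] :
    Primrec₂ fun (n : ℕ) (a : α) => List.replicate n a :=
  (Primrec.list_map (Primrec.list_range.comp .fst) (Primrec.snd.comp₂ .left)).of_eq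
    fun ⟨n, a⟩ => by simp

/-! ### Primitive recursive enumeration of locally analytic proofs -/

/-- A request to extend a list of codes of proofs by the code of the proof that ends with an
instance of rule number `rule` with the given data, applied to the proofs with codes `subs`. -/
structure Instr : Type where
  rule : ℕ
  Γ : List LFormula
  Δ : List LFormula
  Φ : List Formula
  A : Formula
  B : Formula
  p : ℕ
  q : ℕ
  subs : List ℕ

/-- Instructions as tuples. -/
def Instr.equivProd : Instr ≃ ℕ × List LFormula × List LFormula × List Formula ×
    Formula × Formula × ℕ × ℕ × List ℕ where
  toFun t := (t.rule, t.Γ, t.Δ, t.Φ, t.A, t.B, t.p, t.q, t.subs)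
  invFun | (r, Γ, Δ, Φ, A, B, p, q, s) => ⟨r, Γ, Δ, Φ, A, B, p, q, s⟩

noncomputable instance : Primcodable Instr := Primcodable.ofEquiv _ Instr.equivProd

/-- Side condition, conclusion, premises and coded parameters of a rule instance. -/
abbrev RuleData : Type := Bool × List LFormula × List (List LFormula) × List ℕ

open Classical in
/-- The rule instances determined by the data of an instruction, in the order of the numbers of
the rules. -/
noncomputable def Instr.ruleData (t : Instr) : List RuleData :=
  [(true, [left (.var t.p), right (.var t.p)], [], [t.p]),
   (true, t.Γ ++ t.Δ, [t.Γ], [Sequent.code t.Γ, Sequent.code t.Δ]),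
   -- For contraction, `Γ` lists the surplus occurrences that are removed.
   (decide (∀ F ∈ t.Γ, F ∈ t.Δ), t.Δ, [t.Δ ++ t.Γ], [Sequent.code ↑(t.Δ ++ t.Γ)]),
   (decide ((¬ t.p = 0 ∧ ¬ t.q = 0) ∧ ∃ F ∈ t.Γ ++ t.Δ, IsSubformula t.A F.formula), t.Γ ++ t.Δ,
    [t.Γ ++ List.replicate t.p (right t.A), t.Δ ++ List.replicate t.q (left t.A)],
    [Sequent.code t.Γ, Sequent.code t.Δ, t.A.code, t.p, t.q]),
   (true, left .bot :: t.Γ, [], [Sequent.code t.Γ]),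
   (true, right .bot :: t.Γ, [t.Γ], [Sequent.code t.Γ]),
   (true, left (.and t.A t.B) :: t.Γ, [left t.A :: left t.B :: t.Γ],
    [Sequent.code t.Γ, t.A.code, t.B.code]),
   (true, right (.and t.A t.B) :: t.Γ, [right t.A :: t.Γ, right t.B :: t.Γ],
    [Sequent.code t.Γ, t.A.code, t.B.code]),
   (true, left (.or t.A t.B) :: t.Γ, [left t.A :: t.Γ, left t.B :: t.Γ],
    [Sequent.code t.Γ, t.A.code, t.B.code]),
   (true, right (.or t.A t.B) :: t.Γ, [right t.A :: right t.B :: t.Γ],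
    [Sequent.code t.Γ, t.A.code, t.B.code]),
   (true, left (.imp t.A t.B) :: t.Γ, [right t.A :: t.Γ, left t.B :: t.Γ],
    [Sequent.code t.Γ, t.A.code, t.B.code]),
   -- Taking the context from the unlabelled list `Φ` builds in the restriction to one side.
   (true, right (.imp t.A t.B) :: t.Φ.map left, [left t.A :: right t.B :: t.Φ.map left],
    [Sequent.code ↑(t.Φ.map left), t.A.code, t.B.code]),
   (true, left (.excl t.A t.B) :: t.Φ.map right, [left t.A :: right t.B :: t.Φ.map right],
    [Sequent.code ↑(t.Φ.map right), t.A.code, t.B.code]),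
   (true, right (.excl t.A t.B) :: t.Γ, [right t.A :: t.Γ, left t.B :: t.Γ],
    [Sequent.code t.Γ, t.A.code, t.B.code])]

/-- A rule instance can be applied to proofs with codes `subs`, all of which occur in `known`. -/
def Applicable (d : RuleData) (subs known : List ℕ) : Prop :=
  (d.1 = true ∧ subs.map (fun c => c.unpair.1) = d.2.2.1.map fun l : List LFormula => Sequent.code l) ∧
    ∀ c ∈ subs, c ∈ known

/-- The code of the proof described by an instruction. -/
noncomputable def Instr.code (t : Instr) (d : RuleData) : ℕ :=
  codeNode d.2.1 t.rule d.2.2.2 t.subs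

open Classical in
/-- Execution of an instruction on a list of codes of proofs. -/
noncomputable def Instr.exec (t : Instr) (known : List ℕ) : List ℕ :=
  (t.ruleData[t.rule]?.map fun d =>
    if Applicable d t.subs known then t.code d :: known else known).getD known

/-- Execution of a list of instructions, from right to left. -/
noncomputable def execAll (L : List Instr) : List ℕ := L.foldr Instr.exec []

/-- The codes of locally analytic proofs. -/
def IsAnalyticCode (c : ℕ) : Prop := ∃ (S : Sequent) (π : Proof S), π.LocallyAnalytic ∧ π.code = c

/-! ### Correctness and exhaustiveness of the enumeration -/

theorem Proof.unpair_code_fst {S : Sequent} (π : Proof S) : π.code.unpair.1 = S.code := by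
  cases π <;> simp [Proof.code, codeNode]

theorem IsAnalyticCode.exists_proof {c : ℕ} {S : Sequent} (h : IsAnalyticCode c)
    (hc : c.unpair.1 = S.code) : ∃ π : Proof S, π.LocallyAnalytic ∧ π.code = c := by
  obtain ⟨T, π, hπ, rfl⟩ := h
  rw [Proof.unpair_code_fst] at hc
  obtain rfl := Sequent.code_injective hc
  exact ⟨π, hπ, rfl⟩

open Classical in
-- The endsequent is readable from a code and sequent codes are injective, so matching first
-- components yields genuine proofs of the premises.
theorem isAnalyticCode_code {t : Instr} {d : RuleData} (hd : t.ruleData[t.rule]? = some d)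
    (hs : d.1 = true) (hsub : t.subs.map (fun c => c.unpair.1) =
      d.2.2.1.map fun l : List LFormula => Sequent.code l)
    (ha : ∀ c ∈ t.subs, IsAnalyticCode c) : IsAnalyticCode (t.code d) := by
  have zero : t.subs.map (fun c => c.unpair.1) = [] → t.subs = [] := List.map_eq_nil_iff.1
  have one : ∀ S : List LFormula, t.subs.map (fun c => c.unpair.1) = [Sequent.code S] →
      ∃ π : Proof S, π.LocallyAnalytic ∧ t.subs = [π.code] := by
    intro S h
    obtain ⟨c, e, hc⟩ := List.map_eq_singleton_iff.1 h
    obtain ⟨π, hπ, rfl⟩ := (ha c (by simp [e])).exists_proof hc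
    exact ⟨π, hπ, e⟩
  have two : ∀ S T : List LFormula,
      t.subs.map (fun c => c.unpair.1) = [Sequent.code S, Sequent.code T] →
      ∃ (π : Proof S) (ρ : Proof T), π.LocallyAnalytic ∧ ρ.LocallyAnalytic ∧
        t.subs = [π.code, ρ.code] := by
    intro S T h
    obtain ⟨c, l, e, hc, h⟩ := List.map_eq_cons_iff.1 h
    obtain ⟨c', rfl, hc'⟩ := List.map_eq_singleton_iff.1 h
    obtain ⟨π, hπ, rfl⟩ := (ha c (by simp [e])).exists_proof hc
    obtain ⟨ρ, hρ, rfl⟩ := (ha c' (by simp [e])).exists_proof hc'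
    exact ⟨π, ρ, hπ, hρ, e⟩
  obtain ⟨r, hr⟩ : ∃ r, t.rule = r := ⟨_, rfl⟩
  rw [hr] at hd
  have hr' : r < 14 := (List.getElem?_eq_some_iff.1 hd).1
  interval_cases r <;> obtain rfl := Option.some.inj hd
  · have e := zero hsub
    exact ⟨_, .ax t.p, trivial, by rw [Instr.code, hr, e]; rfl⟩
  · obtain ⟨π, hπ, e⟩ := one _ hsub
    exact ⟨_, .weak t.Γ t.Δ π, hπ, by rw [Instr.code, hr, e]; rfl⟩
  · obtain ⟨π, hπ, e⟩ := one _ hsub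
    have hs := of_decide_eq_true hs
    have hc : IsContraction (t.Δ : Sequent) (↑(t.Δ ++ t.Γ) : Sequent) :=
      ⟨by simp [← Multiset.coe_add], fun F hF => (List.mem_append.1 hF).elim id (hs F)⟩
    exact ⟨_, .contr _ _ hc π, hπ, by rw [Instr.code, hr, e]; rfl⟩
  · obtain ⟨π, ρ, hπ, hρ, e⟩ := two _ _ hsub
    obtain ⟨⟨hp, hq⟩, hA⟩ := of_decide_eq_true hs
    exact ⟨_, .mcut t.Γ t.Δ t.A t.p t.q hp hq π ρ, ⟨hA, hπ, hρ⟩, by rw [Instr.code, hr, e]; rfl⟩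
  · have e := zero hsub
    exact ⟨_, .botL t.Γ, trivial, by rw [Instr.code, hr, e]; rfl⟩
  · obtain ⟨π, hπ, e⟩ := one _ hsub
    exact ⟨_, .botR t.Γ π, hπ, by rw [Instr.code, hr, e]; rfl⟩
  · obtain ⟨π, hπ, e⟩ := one _ hsub
    exact ⟨_, .andL t.Γ t.A t.B π, hπ, by rw [Instr.code, hr, e]; rfl⟩
  · obtain ⟨π, ρ, hπ, hρ, e⟩ := two _ _ hsub
    exact ⟨_, .andR t.Γ t.A t.B π ρ, ⟨hπ, hρ⟩, by rw [Instr.code, hr, e]; rfl⟩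
  · obtain ⟨π, ρ, hπ, hρ, e⟩ := two _ _ hsub
    exact ⟨_, .orL t.Γ t.A t.B π ρ, ⟨hπ, hρ⟩, by rw [Instr.code, hr, e]; rfl⟩
  · obtain ⟨π, hπ, e⟩ := one _ hsub
    exact ⟨_, .orR t.Γ t.A t.B π, hπ, by rw [Instr.code, hr, e]; rfl⟩
  · obtain ⟨π, ρ, hπ, hρ, e⟩ := two _ _ hsub
    exact ⟨_, .impL t.Γ t.A t.B π ρ, ⟨hπ, hρ⟩, by rw [Instr.code, hr, e]; rfl⟩
  · obtain ⟨π, hπ, e⟩ := one _ hsub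
    exact ⟨_, .impR t.Φ t.A t.B π, hπ, by rw [Instr.code, hr, e]; rfl⟩
  · obtain ⟨π, hπ, e⟩ := one _ hsub
    exact ⟨_, .exclL t.Φ t.A t.B π, hπ, by rw [Instr.code, hr, e]; rfl⟩
  · obtain ⟨π, ρ, hπ, hρ, e⟩ := two _ _ hsub
    exact ⟨_, .exclR t.Γ t.A t.B π ρ, ⟨hπ, hρ⟩, by rw [Instr.code, hr, e]; rfl⟩

theorem isAnalyticCode_of_mem_execAll {L : List Instr} : ∀ c ∈ execAll L, IsAnalyticCode c := by
  induction L with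
  | nil => intro c hc; simp [execAll] at hc
  | cons t L ih =>
    intro c hc
    change c ∈ t.exec (execAll L) at hc
    unfold Instr.exec at hc
    cases hd : t.ruleData[t.rule]? with
    | none => rw [hd] at hc; exact ih c hc
    | some d =>
      rw [hd, Option.map_some, Option.getD_some] at hc
      split_ifs at hc with h
      · rcases List.mem_cons.1 hc with rfl | hc
        · exact isAnalyticCode_code hd h.1.1 h.1.2 fun c hc => ih c (h.2 c hc)
        · exact ih c hc
      · exact ih c hc

theorem subset_exec (t : Instr) (l : List ℕ) : l ⊆ t.exec l := by
  unfold Instr.exec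
  cases t.ruleData[t.rule]? with
  | none => exact List.Subset.refl _
  | some d =>
    rw [Option.map_some, Option.getD_some]
    split_ifs
    · exact List.subset_cons_self _ _
    · exact List.Subset.refl _

theorem exists_execAll_of_ruleData {L₀ L : List Instr} (hL : execAll L₀ ⊆ execAll L) (t : Instr)
    {d : RuleData} (hd : t.ruleData[t.rule]? = some d) (h : Applicable d t.subs (execAll L)) :
    ∃ L, execAll L₀ ⊆ execAll L ∧ t.code d ∈ execAll L := by
  refine ⟨t :: L, List.Subset.trans hL (subset_exec t _), ?_⟩
  change _ ∈ t.exec (execAll L)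
  rw [Instr.exec, hd, Option.map_some, Option.getD_some, if_pos h]
  exact List.mem_cons_self

open Classical in
-- The arbitrary starting list `L₀` makes the induction pass two-premise rules: the instructions for
-- the second premise extend those for the first, keeping its code available.
theorem exists_execAll_of_analytic {S : Sequent} (π : Proof S) (hπ : π.LocallyAnalytic) :
    ∀ L₀ : List Instr, ∃ L, execAll L₀ ⊆ execAll L ∧ π.code ∈ execAll L := by
  have lift : ∀ Γ : Sequent, ∃ l : List LFormula, (l : Sequent) = Γ :=
    fun Γ => ⟨Γ.toList, Γ.coe_toList⟩
  have lift' : ∀ Φ : Multiset Formula, ∃ l : List Formula, (l : Multiset Formula) = Φ :=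
    fun Γ => ⟨Γ.toList, Γ.coe_toList⟩
  have app1 : ∀ {s : Bool} {C P : List LFormula} {ps : List ℕ} {π : Proof (P : Sequent)}
      {known : List ℕ}, s = true → π.code ∈ known →
      Applicable (s, C, [P], ps) [π.code] known := fun hs h =>
    ⟨⟨hs, by simp [Proof.unpair_code_fst]⟩, by simpa using h⟩
  have app2 : ∀ {s : Bool} {C P Q : List LFormula} {ps : List ℕ} {π : Proof (P : Sequent)}
      {ρ : Proof (Q : Sequent)} {known : List ℕ}, s = true → π.code ∈ known → ρ.code ∈ known →
      Applicable (s, C, [P, Q], ps) [π.code, ρ.code] known := fun hs h h' =>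
    ⟨⟨hs, by simp [Proof.unpair_code_fst]⟩, by simpa using ⟨h, h'⟩⟩
  have app0 : ∀ {C : List LFormula} {ps known : List ℕ},
      Applicable (true, C, [], ps) [] known := ⟨⟨rfl, rfl⟩, by simp⟩
  intro L₀
  induction π generalizing L₀ with
  | ax x =>
    exact exists_execAll_of_ruleData (List.Subset.refl _) ⟨0, [], [], [], .bot, .bot, x, 0, []⟩ rfl
      app0
  | weak Γ Δ π ih =>
    obtain ⟨Γ, rfl⟩ := lift Γ
    obtain ⟨Δ, rfl⟩ := lift Δ
    obtain ⟨L, hL, hc⟩ := ih hπ L₀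
    exact exists_execAll_of_ruleData hL ⟨1, Γ, Δ, [], .bot, .bot, 0, 0, [π.code]⟩ rfl
      (app1 rfl hc)
  | contr Γ Γ' h π ih =>
    obtain ⟨E, rfl⟩ := Multiset.le_iff_exists_add.1 h.1
    obtain ⟨E, rfl⟩ := lift E
    obtain ⟨Δ, rfl⟩ := lift Γ'
    obtain ⟨L, hL, hc⟩ := ih hπ L₀
    refine exists_execAll_of_ruleData hL ⟨2, E, Δ, [], .bot, .bot, 0, 0, [π.code]⟩ rfl
      (app1 (decide_eq_true fun F hF => ?_) hc)
    exact h.2 F (Multiset.mem_add.2 (.inr hF))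
  | mcut Γ Δ C p q hp hq π₁ π₂ ih₁ ih₂ =>
    obtain ⟨Γ, rfl⟩ := lift Γ
    obtain ⟨Δ, rfl⟩ := lift Δ
    obtain ⟨L₁, hL₁, h₁⟩ := ih₁ hπ.2.1 L₀
    obtain ⟨L, hL, h₂⟩ := ih₂ hπ.2.2 L₁
    exact exists_execAll_of_ruleData (List.Subset.trans hL₁ hL)
      ⟨3, Γ, Δ, [], C, .bot, p, q, [π₁.code, π₂.code]⟩ rfl
      (app2 (decide_eq_true ⟨⟨hp, hq⟩, hπ.1⟩) (hL h₁) h₂)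
  | botL Γ =>
    obtain ⟨Γ, rfl⟩ := lift Γ
    exact exists_execAll_of_ruleData (List.Subset.refl _) ⟨4, Γ, [], [], .bot, .bot, 0, 0, []⟩ rfl
      app0
  | botR Γ π ih =>
    obtain ⟨Γ, rfl⟩ := lift Γ
    obtain ⟨L, hL, hc⟩ := ih hπ L₀
    exact exists_execAll_of_ruleData hL ⟨5, Γ, [], [], .bot, .bot, 0, 0, [π.code]⟩ rfl
      (app1 rfl hc)
  | andL Γ A B π ih =>
    obtain ⟨Γ, rfl⟩ := lift Γ
    obtain ⟨L, hL, hc⟩ := ih hπ L₀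
    exact exists_execAll_of_ruleData hL ⟨6, Γ, [], [], A, B, 0, 0, [π.code]⟩ rfl (app1 rfl hc)
  | andR Γ A B π₁ π₂ ih₁ ih₂ =>
    obtain ⟨Γ, rfl⟩ := lift Γ
    obtain ⟨L₁, hL₁, h₁⟩ := ih₁ hπ.1 L₀
    obtain ⟨L, hL, h₂⟩ := ih₂ hπ.2 L₁
    exact exists_execAll_of_ruleData (List.Subset.trans hL₁ hL)
      ⟨7, Γ, [], [], A, B, 0, 0, [π₁.code, π₂.code]⟩ rfl (app2 rfl (hL h₁) h₂)
  | orL Γ A B π₁ π₂ ih₁ ih₂ =>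
    obtain ⟨Γ, rfl⟩ := lift Γ
    obtain ⟨L₁, hL₁, h₁⟩ := ih₁ hπ.1 L₀
    obtain ⟨L, hL, h₂⟩ := ih₂ hπ.2 L₁
    exact exists_execAll_of_ruleData (List.Subset.trans hL₁ hL)
      ⟨8, Γ, [], [], A, B, 0, 0, [π₁.code, π₂.code]⟩ rfl (app2 rfl (hL h₁) h₂)
  | orR Γ A B π ih =>
    obtain ⟨Γ, rfl⟩ := lift Γ
    obtain ⟨L, hL, hc⟩ := ih hπ L₀
    exact exists_execAll_of_ruleData hL ⟨9, Γ, [], [], A, B, 0, 0, [π.code]⟩ rfl (app1 rfl hc)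
  | impL Γ A B π₁ π₂ ih₁ ih₂ =>
    obtain ⟨Γ, rfl⟩ := lift Γ
    obtain ⟨L₁, hL₁, h₁⟩ := ih₁ hπ.1 L₀
    obtain ⟨L, hL, h₂⟩ := ih₂ hπ.2 L₁
    exact exists_execAll_of_ruleData (List.Subset.trans hL₁ hL)
      ⟨10, Γ, [], [], A, B, 0, 0, [π₁.code, π₂.code]⟩ rfl (app2 rfl (hL h₁) h₂)
  | impR Γ A B π ih =>
    obtain ⟨Γ, rfl⟩ := lift' Γ
    obtain ⟨L, hL, hc⟩ := ih hπ L₀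
    exact exists_execAll_of_ruleData hL ⟨11, [], [], Γ, A, B, 0, 0, [π.code]⟩ rfl (app1 rfl hc)
  | exclL Δ A B π ih =>
    obtain ⟨Δ, rfl⟩ := lift' Δ
    obtain ⟨L, hL, hc⟩ := ih hπ L₀
    exact exists_execAll_of_ruleData hL ⟨12, [], [], Δ, A, B, 0, 0, [π.code]⟩ rfl (app1 rfl hc)
  | exclR Γ A B π₁ π₂ ih₁ ih₂ =>
    obtain ⟨Γ, rfl⟩ := lift Γ
    obtain ⟨L₁, hL₁, h₁⟩ := ih₁ hπ.1 L₀
    obtain ⟨L, hL, h₂⟩ := ih₂ hπ.2 L₁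
    exact exists_execAll_of_ruleData (List.Subset.trans hL₁ hL)
      ⟨13, Γ, [], [], A, B, 0, 0, [π₁.code, π₂.code]⟩ rfl (app2 rfl (hL h₁) h₂)

/-! ### Primitive recursiveness of executing instructions -/

namespace Instr

theorem primrec_equivProd : Primrec Instr.equivProd := Primrec.of_equiv

theorem primrec_rule : Primrec Instr.rule := Primrec.fst.comp primrec_equivProd

theorem primrec_Γ : Primrec Instr.Γ := Primrec.fst.comp (Primrec.snd.comp primrec_equivProd)

theorem primrec_Δ : Primrec Instr.Δ :=
  Primrec.fst.comp (Primrec.snd.comp (Primrec.snd.comp primrec_equivProd))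

theorem primrec_Φ : Primrec Instr.Φ :=
  Primrec.fst.comp (Primrec.snd.comp (Primrec.snd.comp (Primrec.snd.comp primrec_equivProd)))

theorem primrec_tail : Primrec fun t : Instr => (t.A, t.B, t.p, t.q, t.subs) :=
  Primrec.snd.comp (Primrec.snd.comp (Primrec.snd.comp (Primrec.snd.comp primrec_equivProd)))

theorem primrec_A : Primrec Instr.A := Primrec.fst.comp primrec_tail

theorem primrec_B : Primrec Instr.B := Primrec.fst.comp (Primrec.snd.comp primrec_tail)

theorem primrec_p : Primrec Instr.p :=
  Primrec.fst.comp (Primrec.snd.comp (Primrec.snd.comp primrec_tail))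

theorem primrec_q : Primrec Instr.q :=
  Primrec.fst.comp (Primrec.snd.comp (Primrec.snd.comp (Primrec.snd.comp primrec_tail)))

theorem primrec_subs : Primrec Instr.subs :=
  Primrec.snd.comp (Primrec.snd.comp (Primrec.snd.comp (Primrec.snd.comp primrec_tail)))

end Instr

theorem primrec_singleton {α β : Type*} [Primcodable α] [Primcodable β] {f : α → β}
    (hf : Primrec f) : Primrec fun a => [f a] :=
  Primrec.list_cons.comp hf (.const [])

open Classical in
theorem primrec_contractionSide :
    Primrec fun t : Instr => decide (∀ F ∈ t.Γ, F ∈ t.Δ) :=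
  ((PrimrecRel.forall_mem_list primrecRel_mem).comp Instr.primrec_Γ Instr.primrec_Δ).decide

open Classical in
theorem primrec_mcutSide :
    Primrec fun t : Instr => decide ((¬ t.p = 0 ∧ ¬ t.q = 0) ∧
      ∃ F ∈ t.Γ ++ t.Δ, IsSubformula t.A F.formula) := by
  have h : PrimrecRel fun (F : LFormula) (A : Formula) => IsSubformula A F.formula :=
    primrecRel_isSubformula.comp .snd (primrec_formula.comp .fst)
  exact PrimrecPred.decide (.and
    (.and (PrimrecPred.not (Primrec.eq.comp Instr.primrec_p (.const 0)))
      (PrimrecPred.not (Primrec.eq.comp Instr.primrec_q (.const 0))))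
    (h.exists_mem_list.comp (Primrec.list_append.comp Instr.primrec_Γ Instr.primrec_Δ)
      Instr.primrec_A))

theorem Instr.primrec_ruleData : Primrec Instr.ruleData := by
  have cΓ := primrec_sequentCode.comp primrec_Γ
  have cΔ := primrec_sequentCode.comp primrec_Δ
  have lA := primrec_left.comp primrec_A
  have rA := primrec_right.comp primrec_A
  have lB := primrec_left.comp primrec_B
  have rB := primrec_right.comp primrec_B
  have cA : Primrec fun t : Instr => t.A.code := Primrec.encode.comp primrec_A
  have cB : Primrec fun t : Instr => t.B.code := Primrec.encode.comp primrec_B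
  have mL : Primrec fun t : Instr => t.Φ.map left :=
    Primrec.list_map primrec_Φ (primrec_left.comp₂ .right)
  have mR : Primrec fun t : Instr => t.Φ.map right :=
    Primrec.list_map primrec_Φ (primrec_right.comp₂ .right)
  have ps := Primrec.list_cons.comp cΓ (Primrec.list_cons.comp cA (primrec_singleton cB))
  have cons : ∀ {β : Type} [Primcodable β] {f : Instr → β} {g : Instr → List β},
      Primrec f → Primrec g → Primrec fun t => f t :: g t := fun hf hg =>
    Primrec.list_cons.comp hf hg
  have app : ∀ {β : Type} [Primcodable β] {f g : Instr → List β},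
      Primrec f → Primrec g → Primrec fun t => f t ++ g t := fun hf hg =>
    Primrec.list_append.comp hf hg
  have row : ∀ {s : Instr → Bool} {C : Instr → List LFormula} {P : Instr → List (List LFormula)}
      {ps : Instr → List ℕ} {r : Instr → List RuleData}, Primrec s → Primrec C → Primrec P →
      Primrec ps → Primrec r → Primrec fun t => (s t, C t, P t, ps t) :: r t :=
    fun hs hC hP hps hr => cons (hs.pair (hC.pair (hP.pair hps))) hr
  have tt : Primrec fun _ : Instr => true := .const true
  have var := primrec_var.comp primrec_p
  have and := primrec_and.comp primrec_A primrec_B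
  have or := primrec_or.comp primrec_A primrec_B
  have imp := primrec_imp.comp primrec_A primrec_B
  have excl := primrec_excl.comp primrec_A primrec_B
  have one {f : Instr → List LFormula} (hf : Primrec f) := primrec_singleton hf
  have two {f g : Instr → List LFormula} (hf : Primrec f) (hg : Primrec g) :=
    cons hf (primrec_singleton hg)
  refine row tt (cons (primrec_left.comp var) (primrec_singleton (primrec_right.comp var)))
    (.const []) (primrec_singleton primrec_p) ?_
  refine row tt (app primrec_Γ primrec_Δ) (one primrec_Γ) (cons cΓ (primrec_singleton cΔ)) ?_
  refine row primrec_contractionSide primrec_Δ (one (app primrec_Δ primrec_Γ))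
    (primrec_singleton (primrec_sequentCode.comp (app primrec_Δ primrec_Γ))) ?_
  refine row primrec_mcutSide (app primrec_Γ primrec_Δ)
    (two (app primrec_Γ (primrec_replicate.comp primrec_p rA))
      (app primrec_Δ (primrec_replicate.comp primrec_q lA)))
    (cons cΓ (cons cΔ (cons cA (cons primrec_p (primrec_singleton primrec_q))))) ?_
  refine row tt (cons (.const _) primrec_Γ) (.const []) (primrec_singleton cΓ) ?_
  refine row tt (cons (.const _) primrec_Γ) (one primrec_Γ) (primrec_singleton cΓ) ?_
  refine row tt (cons (primrec_left.comp and) primrec_Γ) (one (cons lA (cons lB primrec_Γ))) ps ?_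
  refine row tt (cons (primrec_right.comp and) primrec_Γ)
    (two (cons rA primrec_Γ) (cons rB primrec_Γ)) ps ?_
  refine row tt (cons (primrec_left.comp or) primrec_Γ)
    (two (cons lA primrec_Γ) (cons lB primrec_Γ)) ps ?_
  refine row tt (cons (primrec_right.comp or) primrec_Γ) (one (cons rA (cons rB primrec_Γ))) ps ?_
  refine row tt (cons (primrec_left.comp imp) primrec_Γ)
    (two (cons rA primrec_Γ) (cons lB primrec_Γ)) ps ?_
  refine row tt (cons (primrec_right.comp imp) mL) (one (cons lA (cons rB mL)))
    (cons (primrec_sequentCode.comp mL) (cons cA (primrec_singleton cB))) ?_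
  refine row tt (cons (primrec_left.comp excl) mR) (one (cons lA (cons rB mR)))
    (cons (primrec_sequentCode.comp mR) (cons cA (primrec_singleton cB))) ?_
  exact row tt (cons (primrec_right.comp excl) primrec_Γ)
    (two (cons rA primrec_Γ) (cons lB primrec_Γ)) ps (.const [])

theorem primrecRel_applicable :
    PrimrecRel fun (d : RuleData) (p : List ℕ × List ℕ) => Applicable d p.1 p.2 := by
  have hp : Primrec fun x : RuleData × List ℕ × List ℕ =>
      x.1.2.2.1.map fun l : List LFormula => Sequent.code l :=
    Primrec.list_map (Primrec.fst.comp (Primrec.snd.comp (Primrec.snd.comp Primrec.fst)))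
      (primrec_sequentCode.comp₂ .right)
  have hs : Primrec fun x : RuleData × List ℕ × List ℕ => x.2.1.map fun c => c.unpair.1 :=
    Primrec.list_map (Primrec.fst.comp Primrec.snd)
      ((Primrec.fst.comp Primrec.unpair).comp₂ .right)
  exact .and (.and (Primrec.eq.comp (Primrec.fst.comp Primrec.fst) (.const true))
    (Primrec.eq.comp hs hp)) ((PrimrecRel.forall_mem_list primrecRel_mem).comp
      (Primrec.fst.comp Primrec.snd) (Primrec.snd.comp Primrec.snd))

theorem Instr.primrec_code : Primrec₂ Instr.code := by
  refine Primrec₂.natPair.comp (primrec_sequentCode.comp (.comp .fst (.comp .snd .snd)))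
    (Primrec₂.natPair.comp (primrec_rule.comp .fst) (Primrec₂.natPair.comp
      (Primrec.encode.comp (.comp .snd (.comp .snd (.comp .snd .snd))))
      (Primrec.encode.comp (primrec_subs.comp .fst))))

open Classical in
theorem Instr.primrec_exec : Primrec₂ Instr.exec := by
  have hd : Primrec fun x : Instr × List ℕ => x.1.ruleData[x.1.rule]? :=
    Primrec.list_getElem?.comp (primrec_ruleData.comp .fst) (primrec_rule.comp .fst)
  refine Primrec.option_getD.comp (Primrec.option_map hd (g := fun x d => _) ?_) .snd
  exact Primrec.ite
    (primrecRel_applicable.comp .snd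
      ((primrec_subs.comp (.comp .fst .fst)).pair (.comp .snd .fst)))
    (Primrec.list_cons.comp (primrec_code.comp (.comp .fst .fst) .snd) (.comp .snd .fst))
    (.comp .snd .fst)

theorem primrec_execAll : Primrec execAll :=
  Primrec.list_foldr .id (.const []) (Instr.primrec_exec.comp₂ (Primrec.fst.comp₂ .right)
    (Primrec.snd.comp₂ .right))

/-! ### Unbounded search for a locally analytic proof -/

open Classical in
/-- The result of testing whether `n` encodes a list of instructions together with the code of a
proof that it constructs and that has the same endsequent as the proof with code `c`. -/
noncomputable def searchStep (c n : ℕ) : Option ℕ :=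
  (decode (α := List Instr × ℕ) n).bind fun x =>
    if x.2 ∈ execAll x.1 ∧ x.2.unpair.1 = c.unpair.1 then some x.2 else none

theorem primrec_searchStep : Primrec₂ searchStep := by
  have h1 : Primrec fun n : ℕ => n.unpair.1 := Primrec.fst.comp Primrec.unpair
  refine Primrec.option_bind (Primrec.decode.comp .snd) (g := fun y x => _) ?_
  exact Primrec.ite (.and
    (primrecRel_mem.comp (.comp .snd .snd) (primrec_execAll.comp (.comp .fst .snd)))
    (Primrec.eq.comp (h1.comp (.comp .snd .snd)) (h1.comp (.comp .fst .fst))))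
    (Primrec.option_some.comp (.comp .snd .snd)) (.const none)

theorem mem_searchStep {c n x : ℕ} : x ∈ searchStep c n ↔
    ∃ L : List Instr, decode n = some (L, x) ∧ x ∈ execAll L ∧ x.unpair.1 = c.unpair.1 := by
  simp only [searchStep, Option.mem_def, Option.bind_eq_some_iff, Option.ite_none_right_eq_some,
    Option.some.injEq, Prod.exists]
  constructor
  · rintro ⟨L, y, h, h', rfl⟩
    exact ⟨L, h, h'⟩
  · rintro ⟨L, h, h'⟩
    exact ⟨L, x, h, h', rfl⟩

theorem exists_partrec_analytic : ∃ f : ℕ →. ℕ, Nat.Partrec f ∧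
    ∀ (S : Sequent) (π : Proof S), ∃ π' : Proof S, π'.LocallyAnalytic ∧ π'.code ∈ f π.code := by
  refine ⟨fun c => Nat.rfindOpt (searchStep c),
    Partrec.nat_iff.1 (Partrec.rfindOpt primrec_searchStep.to_comp), fun S π => ?_⟩
  obtain ⟨ρ, hρ⟩ := analyticCutProperty S ⟨π⟩
  obtain ⟨L, -, hL⟩ := exists_execAll_of_analytic ρ hρ []
  -- The proof `ρ` only ensures that the search halts; the output `x` may be another proof, correct
  -- because every successful candidate is.
  have hdom : (Nat.rfindOpt (searchStep π.code)).Dom :=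
    Nat.rfindOpt_dom.2 ⟨encode (L, ρ.code), ρ.code,
      mem_searchStep.2 ⟨L, encodek _, hL, by rw [ρ.unpair_code_fst, π.unpair_code_fst]⟩⟩
  obtain ⟨x, hx⟩ := Part.dom_iff_mem.1 hdom
  obtain ⟨n, hn⟩ := Nat.rfindOpt_spec hx
  obtain ⟨L', -, hx', he⟩ := mem_searchStep.1 hn
  obtain ⟨π', hπ', rfl⟩ := (isAnalyticCode_of_mem_execAll x hx').exists_proof
    (he.trans π.unpair_code_fst)
  exact ⟨π', hπ', hx⟩

end BiInt

/-- The sequent calculus `BiInt` has the analytic cut property, and there is an algorithm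
(a partial recursive function on codes, defined on the code of every proof) that transforms each
proof into a locally analytic proof of the same endsequent. -/
theorem mainTheorem4 :
    BiInt.AnalyticCutProperty ∧
      ∃ f : ℕ →. ℕ, Nat.Partrec f ∧
        ∀ (S : BiInt.Sequent) (π : BiInt.Proof S),
          ∃ π' : BiInt.Proof S, π'.LocallyAnalytic ∧ π'.code ∈ f π.code :=
  ⟨BiInt.analyticCutProperty, BiInt.exists_partrec_analytic⟩
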